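/- Let $n\ge 1$, let $f\in\mathcal S(\mathbb R^n)$ be a complex-valued Schwartz function, let $\hat f(\xi)=\int_{\mathbb R^n}e^{2\pi i\,\xi\cdot x}f(x)\,dx$, put $g(x)=|x|^{n/2}f(x)$, and let $\psi=(\ln\Gamma)'$ on $(0,\infty)$ and $D=\psi(n/4)-\ln\pi$. Then all the integrals below converge absolutely, and $$\int_{\mathbb R^n}\ln|x|\,|f(x)|^2\,dx+\int_{\mathbb R^n}\ln|\xi|\,|\hat f(\xi)|^2\,d\xi-D\int_{\mathbb R^n}|f(x)|^2\,dx=\frac14\,\pi^{-n/2}\,\Gamma(n/2)\int_{\mathbb R^n\times\mathbb R^n}\frac{|g(x)-g(y)|^2}{|x-y|^n}\,|x|^{-n/2}|y|^{-n/2}\,dx\,dy .$$ Consequently the logarithmic uncertainty inequality $$\int_{\mathbb R^n}\ln|x|\,|f(x)|^2\,dx+\int_{\mathbb R^n}\ln|\xi|\,|\hat f(\xi)|^2\,d\xi\ \ge\ D\int_{\mathbb R^n}|f(x)|^2\,dx$$ has no extremals: it is strict for every nonzero $f\in\mathcal S(\mathbb R^n)$. -/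

import Mathlib

open MeasureTheory
open scoped SchwartzMap

namespace LogUncertainty

/-- The digamma function on the positive reals, the derivative of the logarithm of Gamma. -/
noncomputable def psi (t : ℝ) : ℝ :=
  deriv (fun s : ℝ => Real.log (Real.Gamma s)) t

/-- The constant `D = psi (n/4) - ln pi` of logarithmic uncertainty in dimension `n`. -/
noncomputable def logConst (n : ℕ) : ℝ :=
  psi ((n : ℝ) / 4) - Real.log Real.pi

/-- The Fourier transform with kernel `exp (2 pi i ⟨ξ, x⟩)` (the sign is the positive one). -/
noncomputable def hat {n : ℕ} (f : EuclideanSpace ℝ (Fin n) → ℂ)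
    (ξ : EuclideanSpace ℝ (Fin n)) : ℂ :=
  ∫ x : EuclideanSpace ℝ (Fin n),
    Complex.exp (2 * (Real.pi : ℂ) * Complex.I * ((inner ℝ ξ x : ℝ) : ℂ)) * f x

/-- The function `g(x) = |x|^(n/2) f(x)`. -/
noncomputable def weighted {n : ℕ} (f : EuclideanSpace ℝ (Fin n) → ℂ)
    (x : EuclideanSpace ℝ (Fin n)) : ℂ :=
  ((‖x‖ ^ ((n : ℝ) / 2) : ℝ) : ℂ) * f x

/-- The integrand `|g(x) - g(y)|^2 / |x - y|^n * |x|^(-n/2) * |y|^(-n/2)`, at `p = (x, y)`. -/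
noncomputable def besovIntegrand {n : ℕ} (g : EuclideanSpace ℝ (Fin n) → ℂ)
    (p : EuclideanSpace ℝ (Fin n) × EuclideanSpace ℝ (Fin n)) : ℝ :=
  ‖g p.1 - g p.2‖ ^ 2 / ‖p.1 - p.2‖ ^ n *
    ‖p.1‖ ^ (-((n : ℝ) / 2)) * ‖p.2‖ ^ (-((n : ℝ) / 2))

end LogUncertainty

/-!
The identity is the derivative at `a = 0` of a one-parameter family of identities, one for each
small `a > 0`, in which the logarithms are replaced by powers.

For the Riesz kernel `riesz a = Γ(n/2 - a) / Γ(a) * (π |x|²)^(a - n/2)`, whose Fourier transform is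
`(π |ξ|²)^(-a)`, Plancherel's theorem (`integral_rpow_mul_norm_sq_hat`) reads
`∫ (π |ξ|²)^(-a) |f̂|² = ∬ riesz a (x - y) f(x) conj(f(y))`.
Put `f = |x|^(-n/2) g` and expand
`2 Re (g(x) conj(g(y))) = |g(x)|² + |g(y)|² - |g(x) - g(y)|²`. The two diagonal terms are explicit,
because `|x|^(-n/2)` is a multiple of `riesz (n/4)` and the Riesz kernels form a convolution
semigroup (`lintegral_riesz_mul_riesz`). The result is the ground state representation
(`ground_state`): with `H(a) = π^a Γ(n/4 - a) / Γ(n/4 + a)`,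
`∫ (π |ξ|²)^(-a) |f̂|² =
H(a) ∫ |x|^(2a) |f|² - ½ ∬ |g(x) - g(y)|² |x|^(-n/2) |y|^(-n/2) riesz a (x - y)`.

Both single integrals equal `‖f‖²` at `a = 0` and are differentiable there
(`hasDerivAt_integral_norm_rpow`), with derivatives producing the logarithmic integrals, and
`H'(0) = ln π - 2 ψ(n/4)`. On the other side `riesz a` is `a |x|^(2a - n)` up to a factor tending to
`π^(-n/2) Γ(n/2)`. Dividing by `a` and letting `a → 0+` gives the identity: Fatou's lemma shows that
the limiting double integral converges, and then dominated convergence evaluates it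
(`integrable_of_tendsto_integral_rpow`, `integral_besovIntegrand`).

The double integral vanishes only if the continuous function `g` is constant; since `g(0) = 0`,
this forces `f = 0` (`integral_besovIntegrand_pos`).

The Riesz kernels are handled as superpositions `∫ t^(a-1) heat t dt` of Gaussians, so that only
the Fourier transform and the convolution of Gaussians enter.
-/

namespace LogUncertainty
open Set Filter Topology
open scoped ENNReal Real FourierTransform ComplexConjugate

variable {n : ℕ}

/-! ### Heat and Riesz kernels -/

/-- The heat kernel with Fourier transform `exp (-π t ‖ξ‖²)`; meaningful for `t > 0`. -/
noncomputable def heat (t : ℝ) (x : EuclideanSpace ℝ (Fin n)) : ℝ :=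
  t ^ (-((n : ℝ) / 2)) * Real.exp (-(π * ‖x‖ ^ 2 / t))

/-- The Riesz kernel, normalised so that its Fourier transform is `(π ‖ξ‖²)^(-a)`; meaningful for
`0 < a < n / 2` and `x ≠ 0`. -/
noncomputable def riesz (a : ℝ) (x : EuclideanSpace ℝ (Fin n)) : ℝ :=
  Real.Gamma ((n : ℝ) / 2 - a) / Real.Gamma a * (π * ‖x‖ ^ 2) ^ (a - (n : ℝ) / 2)

lemma heat_pos {t : ℝ} (ht : 0 < t) (x : EuclideanSpace ℝ (Fin n)) : 0 < heat t x := by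
  unfold heat; positivity

lemma measurable_heat : Measurable fun p : ℝ × EuclideanSpace ℝ (Fin n) => heat p.1 p.2 := by
  unfold heat; fun_prop

lemma measurable_riesz (a : ℝ) : Measurable (riesz (n := n) a) := by
  unfold riesz; fun_prop

lemma riesz_nonneg {a : ℝ} (ha : 0 < a) (han : a < (n : ℝ) / 2) (x : EuclideanSpace ℝ (Fin n)) :
    0 ≤ riesz a x := by
  unfold riesz
  have := Real.Gamma_pos_of_pos ha
  have := Real.Gamma_pos_of_pos (sub_pos.2 han)
  positivity

lemma riesz_neg (a : ℝ) (x : EuclideanSpace ℝ (Fin n)) : riesz a (-x) = riesz a x := by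
  simp [riesz]

/-- A nonzero value of the Bochner integral certifies integrability. -/
lemma lintegral_ofReal_of_integral_eq {α : Type*} [MeasurableSpace α] {μ : Measure α} {f : α → ℝ}
    {c : ℝ} (h0 : 0 ≤ᵐ[μ] f) (hc : 0 < c) (h : ∫ x, f x ∂μ = c) :
    ∫⁻ x, ENNReal.ofReal (f x) ∂μ = ENNReal.ofReal c := by
  have hi : Integrable f μ := Integrable.of_integral_ne_zero (by rw [h]; exact hc.ne')
  rw [← ofReal_integral_eq_lintegral_ofReal hi h0, h]

/-- Completing the square in a product of two heat kernels. -/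
lemma heat_mul_heat {s t : ℝ} (hs : 0 < s) (ht : 0 < t) (x y : EuclideanSpace ℝ (Fin n)) :
    heat t (x - y) * heat s y =
      (t * s) ^ (-((n : ℝ) / 2)) * Real.exp (-(π * ‖x‖ ^ 2 / (t + s))) *
        Real.exp (-(π * (t + s) / (t * s)) * ‖y - (s / (t + s)) • x‖ ^ 2) := by
  unfold heat
  rw [Real.mul_rpow ht.le hs.le, mul_mul_mul_comm, mul_assoc, mul_assoc, ← Real.exp_add,
    ← Real.exp_add, mul_assoc]
  congr 3
  rw [norm_sub_sq_real, norm_sub_sq_real, norm_smul, inner_smul_right, real_inner_comm x y,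
    Real.norm_eq_abs, abs_of_pos (by positivity)]
  have : t + s ≠ 0 := by positivity
  field_simp
  ring

/-- The heat kernels form a convolution semigroup. -/
lemma lintegral_heat_mul_heat {s t : ℝ} (hs : 0 < s) (ht : 0 < t) (x : EuclideanSpace ℝ (Fin n)) :
    ∫⁻ y, ENNReal.ofReal (heat t (x - y) * heat s y) = ENNReal.ofReal (heat (t + s) x) := by
  apply lintegral_ofReal_of_integral_eq
  · exact ae_of_all _ fun y => (mul_pos (heat_pos ht _) (heat_pos hs _)).le
  · exact heat_pos (by positivity) _
  simp_rw [heat_mul_heat hs ht, integral_const_mul]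
  rw [integral_sub_right_eq_self
    (fun y : EuclideanSpace ℝ (Fin n) => Real.exp (-(π * (t + s) / (t * s)) * ‖y‖ ^ 2)),
    GaussianFourier.integral_rexp_neg_mul_sq_norm (by positivity), finrank_euclideanSpace,
    Fintype.card_fin, heat, mul_right_comm]
  congr 1
  rw [show π / (π * (t + s) / (t * s)) = (t * s) * (t + s)⁻¹ by field_simp,
    Real.mul_rpow (x := t * s) (by positivity) (by positivity), ← mul_assoc,
    ← Real.rpow_add (by positivity), neg_add_cancel, Real.rpow_zero, one_mul,
    Real.rpow_neg (by positivity), Real.inv_rpow (by positivity)]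

lemma integral_rpow_mul_heat {a : ℝ} (han : a < (n : ℝ) / 2)
    {x : EuclideanSpace ℝ (Fin n)} (hx : x ≠ 0) :
    ∫ t in Ioi (0 : ℝ), t ^ (a - 1) * heat t x =
      Real.Gamma ((n : ℝ) / 2 - a) * (π * ‖x‖ ^ 2) ^ (a - (n : ℝ) / 2) := by
  have hx' : 0 < ‖x‖ := norm_pos_iff.2 hx
  have hr : 0 < π * ‖x‖ ^ 2 := by positivity
  -- the substitution `t ↦ 1 / t` leads to Euler's integral for `Γ(n/2 - a)`
  have h1 := integral_comp_rpow_Ioi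
    (fun t : ℝ => t ^ ((n : ℝ) / 2 - a - 1) * Real.exp (-(π * ‖x‖ ^ 2 * t)))
    (p := -1) (by norm_num)
  rw [Real.integral_rpow_mul_exp_neg_mul_Ioi (sub_pos.2 han) hr, one_div,
    Real.inv_rpow hr.le, ← Real.rpow_neg hr.le, neg_sub, mul_comm _ (Real.Gamma _)] at h1
  rw [← h1]
  refine setIntegral_congr_fun measurableSet_Ioi fun t (ht : 0 < t) => ?_
  simp only [heat, smul_eq_mul]
  rw [← Real.rpow_mul ht.le, ← mul_assoc, ← mul_assoc, abs_neg, abs_one, one_mul,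
    ← Real.rpow_add ht, ← Real.rpow_add ht, Real.rpow_neg_one, ← div_eq_mul_inv]
  congr 2
  ring

lemma lintegral_rpow_mul_heat {a : ℝ} (ha : 0 < a) (han : a < (n : ℝ) / 2)
    {x : EuclideanSpace ℝ (Fin n)} (hx : x ≠ 0) :
    ∫⁻ t in Ioi (0 : ℝ), ENNReal.ofReal (t ^ (a - 1) * heat t x) =
      ENNReal.ofReal (Real.Gamma a * riesz a x) := by
  have hx' : 0 < ‖x‖ := norm_pos_iff.2 hx
  have hG := Real.Gamma_pos_of_pos ha
  have hG' := Real.Gamma_pos_of_pos (sub_pos.2 han)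
  have : Real.Gamma a * riesz a x =
      Real.Gamma ((n : ℝ) / 2 - a) * (π * ‖x‖ ^ 2) ^ (a - (n : ℝ) / 2) := by
    rw [riesz]; field_simp
  rw [this]
  apply lintegral_ofReal_of_integral_eq
  · filter_upwards [ae_restrict_mem measurableSet_Ioi] with t ht
    exact mul_nonneg (Real.rpow_nonneg (le_of_lt ht) _) (heat_pos ht _).le
  · positivity
  · exact integral_rpow_mul_heat han hx

lemma lintegral_beta_scaled {a b u : ℝ} (ha : 0 < a) (hb : 0 < b) (hu : 0 < u) :
    ∫⁻ t in Ioo 0 u, ENNReal.ofReal (t ^ (a - 1) * (u - t) ^ (b - 1)) =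
      ENNReal.ofReal (ProbabilityTheory.beta a b * u ^ (a + b - 1)) := by
  have hB := ProbabilityTheory.beta_pos ha hb
  apply lintegral_ofReal_of_integral_eq
  · filter_upwards [ae_restrict_mem measurableSet_Ioo] with t ht
    exact mul_nonneg (Real.rpow_nonneg ht.1.le _) (Real.rpow_nonneg (sub_pos.2 ht.2).le _)
  · positivity
  have h := Complex.betaIntegral_scaled a b hu
  rw [intervalIntegral.integral_of_le hu.le, integral_Ioc_eq_integral_Ioo,
    Complex.betaIntegral_eq_Gamma_mul_div _ _ (by simpa) (by simpa)] at h
  have h2 : ∫ t in Ioo 0 u, (t : ℂ) ^ ((a : ℂ) - 1) * ((u : ℂ) - t) ^ ((b : ℂ) - 1) =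
      ((∫ t in Ioo 0 u, t ^ (a - 1) * (u - t) ^ (b - 1) : ℝ) : ℂ) := by
    rw [← integral_complex_ofReal]
    refine setIntegral_congr_fun measurableSet_Ioo fun t ht => ?_
    have := ht.1.le
    have := (sub_pos.2 ht.2).le
    rw [Complex.ofReal_mul, Complex.ofReal_cpow (by assumption),
      Complex.ofReal_cpow (by assumption)]
    push_cast
    rfl
  rw [h2] at h
  apply Complex.ofReal_injective
  rw [h, ProbabilityTheory.beta, Complex.ofReal_mul, Complex.ofReal_cpow hu.le]
  simp only [Complex.ofReal_div, Complex.ofReal_mul, ← Complex.Gamma_ofReal, Complex.ofReal_add,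
    Complex.ofReal_sub, Complex.ofReal_one]
  ring

/-- The substitution `u = t + s`: the functions `t^(a-1) / Γ(a)` on `(0, ∞)` form a convolution
semigroup, so integrating `heat (t + s)` against two of them gives a single such integral. -/
lemma lintegral_convolution_rpow_heat {a b : ℝ} (ha : 0 < a) (hb : 0 < b)
    (x : EuclideanSpace ℝ (Fin n)) :
    ∫⁻ t in Ioi (0 : ℝ), ∫⁻ s in Ioi (0 : ℝ),
        ENNReal.ofReal (t ^ (a - 1) * s ^ (b - 1) * heat (t + s) x) =
      ENNReal.ofReal (ProbabilityTheory.beta a b) *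
        ∫⁻ u in Ioi (0 : ℝ), ENNReal.ofReal (u ^ (a + b - 1) * heat u x) := by
  -- the integrand in the variables `(t, u)`, extended by zero outside `0 < t < u`
  set K : ℝ → ℝ → ℝ≥0∞ := fun t u =>
    {p : ℝ × ℝ | 0 < p.1 ∧ p.1 < p.2}.indicator
      (fun p => ENNReal.ofReal (p.1 ^ (a - 1) * (p.2 - p.1) ^ (b - 1) * heat p.2 x)) (t, u) with hK
  have hmeas : Measurable (Function.uncurry K) := by
    refine Measurable.indicator ?_ ?_
    · have : Measurable fun p : ℝ × ℝ => heat p.2 x :=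
        measurable_heat.comp (measurable_snd.prodMk measurable_const)
      fun_prop
    · exact (measurableSet_lt measurable_const measurable_fst).inter
        (measurableSet_lt measurable_fst measurable_snd)
  have h1 : ∀ t ∈ Ioi (0 : ℝ), ∫⁻ s in Ioi (0 : ℝ),
      ENNReal.ofReal (t ^ (a - 1) * s ^ (b - 1) * heat (t + s) x) = ∫⁻ u, K t u := by
    intro t ht
    rw [← lintegral_indicator measurableSet_Ioi, ← lintegral_sub_right_eq_self _ t]
    refine lintegral_congr fun u => ?_
    simp only [hK, indicator, mem_Ioi, mem_ofPred_eq, sub_pos, mem_Ioi.1 ht, true_and,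
      add_sub_cancel]
  have h2 : ∀ t ∉ Ioi (0 : ℝ), ∫⁻ u, K t u = 0 := by
    intro t ht
    have : ∀ u, K t u = 0 := fun u => indicator_of_notMem (fun h => ht h.1) _
    simp [this]
  have h3 : ∀ u ∈ Ioi (0 : ℝ), ∫⁻ t, K t u = ENNReal.ofReal (ProbabilityTheory.beta a b) *
      ENNReal.ofReal (u ^ (a + b - 1) * heat u x) := by
    intro u hu
    have hu' : 0 < u := hu
    have hh := heat_pos hu' x
    have : ∀ t, K t u = (Ioo 0 u).indicator
        (fun t => ENNReal.ofReal (heat u x) *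
          ENNReal.ofReal (t ^ (a - 1) * (u - t) ^ (b - 1))) t := by
      intro t
      simp only [hK, indicator, mem_ofPred_eq, mem_Ioo]
      split_ifs
      · rw [← ENNReal.ofReal_mul hh.le, mul_comm]
      · rfl
    simp_rw [this]
    rw [lintegral_indicator measurableSet_Ioo, lintegral_const_mul' _ _ ENNReal.ofReal_ne_top,
      lintegral_beta_scaled ha hb hu', ENNReal.ofReal_mul (ProbabilityTheory.beta_pos ha hb).le,
      ENNReal.ofReal_mul (by positivity)]
    ring
  have h4 : ∀ u ∉ Ioi (0 : ℝ), ∫⁻ t, K t u = 0 := by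
    intro u hu
    have : ∀ t, K t u = 0 := fun t => indicator_of_notMem (fun h => hu (h.1.trans h.2)) _
    simp [this]
  rw [setLIntegral_congr_fun measurableSet_Ioi h1,
    setLIntegral_eq_of_support_subset (fun t ht => by_contra fun h => ht (h2 t h)),
    lintegral_lintegral_swap hmeas.aemeasurable,
    ← setLIntegral_eq_of_support_subset (s := Ioi 0) (fun u hu => by_contra fun h => hu (h4 u h)),
    setLIntegral_congr_fun measurableSet_Ioi h3,
    lintegral_const_mul' _ _ ENNReal.ofReal_ne_top]

/-- The Riesz kernels form a convolution semigroup. -/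
lemma lintegral_riesz_mul_riesz (hn : 1 ≤ n) {a b : ℝ} (ha : 0 < a) (hb : 0 < b)
    (hab : a + b < (n : ℝ) / 2)
    {x : EuclideanSpace ℝ (Fin n)} (hx : x ≠ 0) :
    ∫⁻ y, ENNReal.ofReal (riesz a (x - y) * riesz b y) = ENNReal.ofReal (riesz (a + b) x) := by
  have : Nonempty (Fin n) := ⟨⟨0, hn⟩⟩
  have hGa := Real.Gamma_pos_of_pos ha
  have hGb := Real.Gamma_pos_of_pos hb
  set μ := (volume : Measure ℝ).restrict (Ioi 0)
  have hm : ∀ c : ℝ, Measurable fun p : ℝ × EuclideanSpace ℝ (Fin n) =>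
      ENNReal.ofReal (p.1 ^ (c - 1) * heat p.1 p.2) := fun c => by
    have := measurable_heat (n := n)
    fun_prop
  have h1 : ∀ᵐ y : EuclideanSpace ℝ (Fin n),
      ENNReal.ofReal (Real.Gamma a * Real.Gamma b) *
        ENNReal.ofReal (riesz a (x - y) * riesz b y) =
      ∫⁻ z, ENNReal.ofReal (z.1 ^ (a - 1) * heat z.1 (x - y)) *
        ENNReal.ofReal (z.2 ^ (b - 1) * heat z.2 y) ∂(μ.prod μ) := by
    filter_upwards [Measure.ae_ne volume 0, Measure.ae_ne volume x] with y hy hyx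
    have m1 : Measurable fun t : ℝ => ENNReal.ofReal (t ^ (a - 1) * heat t (x - y)) :=
      (hm a).comp (measurable_id.prodMk measurable_const)
    have m2 : Measurable fun t : ℝ => ENNReal.ofReal (t ^ (b - 1) * heat t y) :=
      (hm b).comp (measurable_id.prodMk measurable_const)
    rw [lintegral_prod_mul m1.aemeasurable m2.aemeasurable,
      lintegral_rpow_mul_heat ha (by linarith) (sub_ne_zero.2 (Ne.symm hyx)),
      lintegral_rpow_mul_heat hb (by linarith) hy]
    have := riesz_nonneg ha (by linarith : a < (n : ℝ) / 2) (x - y)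
    rw [← ENNReal.ofReal_mul (by positivity), ← ENNReal.ofReal_mul (by positivity)]
    congr 1
    ring
  have hmeas : Measurable (Function.uncurry fun (y : EuclideanSpace ℝ (Fin n)) (z : ℝ × ℝ) =>
      ENNReal.ofReal (z.1 ^ (a - 1) * heat z.1 (x - y)) *
        ENNReal.ofReal (z.2 ^ (b - 1) * heat z.2 y)) := by
    have e1 : Measurable fun q : EuclideanSpace ℝ (Fin n) × ℝ × ℝ =>
        ENNReal.ofReal (q.2.1 ^ (a - 1) * heat q.2.1 (x - q.1)) :=
      (hm a).comp ((measurable_fst.comp measurable_snd).prodMk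
        (measurable_const.sub measurable_fst))
    have e2 : Measurable fun q : EuclideanSpace ℝ (Fin n) × ℝ × ℝ =>
        ENNReal.ofReal (q.2.2 ^ (b - 1) * heat q.2.2 q.1) :=
      (hm b).comp ((measurable_snd.comp measurable_snd).prodMk measurable_fst)
    exact e1.mul e2
  have h2 : ∀ z ∈ Ioi (0 : ℝ) ×ˢ Ioi (0 : ℝ),
      ∫⁻ y : EuclideanSpace ℝ (Fin n), ENNReal.ofReal (z.1 ^ (a - 1) * heat z.1 (x - y)) *
        ENNReal.ofReal (z.2 ^ (b - 1) * heat z.2 y) =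
      ENNReal.ofReal (z.1 ^ (a - 1) * z.2 ^ (b - 1) * heat (z.1 + z.2) x) := by
    rintro ⟨t, s⟩ ⟨ht, hs⟩
    have ht : 0 < t := ht
    have hs : 0 < s := hs
    have h : ∀ y : EuclideanSpace ℝ (Fin n), ENNReal.ofReal (t ^ (a - 1) * heat t (x - y)) *
        ENNReal.ofReal (s ^ (b - 1) * heat s y) =
        ENNReal.ofReal (t ^ (a - 1) * s ^ (b - 1)) *
          ENNReal.ofReal (heat t (x - y) * heat s y) := by
      intro y
      have := heat_pos ht (x - y)
      rw [← ENNReal.ofReal_mul (by positivity), ← ENNReal.ofReal_mul (by positivity)]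
      congr 1
      ring
    simp_rw [h]
    rw [lintegral_const_mul' _ _ ENNReal.ofReal_ne_top, lintegral_heat_mul_heat hs ht,
      ← ENNReal.ofReal_mul (by positivity)]
  have key : ENNReal.ofReal (Real.Gamma a * Real.Gamma b) *
      ∫⁻ y, ENNReal.ofReal (riesz a (x - y) * riesz b y) =
      ENNReal.ofReal (Real.Gamma a * Real.Gamma b) * ENNReal.ofReal (riesz (a + b) x) := by
    rw [← lintegral_const_mul' _ _ ENNReal.ofReal_ne_top, lintegral_congr_ae h1,
      lintegral_lintegral_swap hmeas.aemeasurable, Measure.prod_restrict,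
      setLIntegral_congr_fun (measurableSet_Ioi.prod measurableSet_Ioi) h2,
      ← Measure.prod_restrict, lintegral_prod, lintegral_convolution_rpow_heat ha hb,
      lintegral_rpow_mul_heat (by positivity) hab hx,
      ← ENNReal.ofReal_mul (ProbabilityTheory.beta_pos ha hb).le,
      ← ENNReal.ofReal_mul (by positivity), ProbabilityTheory.beta]
    · have := Real.Gamma_pos_of_pos (add_pos ha hb)
      congr 1
      field_simp
    · refine Measurable.aemeasurable ?_
      have : Measurable fun z : ℝ × ℝ => heat (z.1 + z.2) x :=
        measurable_heat.comp ((measurable_fst.add measurable_snd).prodMk measurable_const)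
      fun_prop
  exact (ENNReal.mul_right_inj (by simpa using mul_pos hGa hGb) ENNReal.ofReal_ne_top).1 key

/-! ### Moments of a Schwartz function -/

lemma integrable_norm_rpow_mul_sq (hn : 1 ≤ n) (h : 𝓢(EuclideanSpace ℝ (Fin n), ℂ)) {r : ℝ}
    (hr : -1 < r) (hr1 : r ≤ 1) :
    Integrable fun x : EuclideanSpace ℝ (Fin n) => ‖x‖ ^ r * ‖h x‖ ^ 2 := by
  have : Nonempty (Fin n) := ⟨⟨0, hn⟩⟩
  obtain ⟨C, hC0, hC⟩ := h.decay 0 0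
  simp only [pow_zero, one_mul, norm_iteratedFDeriv_zero] at hC
  have hball : IntegrableOn (fun x : EuclideanSpace ℝ (Fin n) => ‖x‖ ^ r)
      (Metric.ball 0 1) := by
    rw [integrableOn_fun_norm_addHaar (volume : Measure (EuclideanSpace ℝ (Fin n)))
      (f := fun y : ℝ => y ^ r), finrank_euclideanSpace, Fintype.card_fin]
    have h1 : IntegrableOn (fun y : ℝ => y ^ (((n - 1 : ℕ) : ℝ) + r)) (Ioo 0 1) := by
      rw [intervalIntegral.integrableOn_Ioo_rpow_iff one_pos]
      have : (0 : ℝ) ≤ ((n - 1 : ℕ) : ℝ) := Nat.cast_nonneg _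
      linarith
    refine h1.congr_fun (fun y hy => ?_) measurableSet_Ioo
    simp only [smul_eq_mul]
    rw [Real.rpow_add hy.1, Real.rpow_natCast]
  have hb := ((integrable_indicator_iff Metric.isOpen_ball.measurableSet).2 hball).const_mul (C ^ 2)
  have h0 : Integrable fun x => ‖h x‖ := h.integrable.norm
  have h1 : Integrable fun x => ‖x‖ ^ 1 * ‖h x‖ := h.integrable_pow_mul volume 1
  refine (hb.add ((h0.add h1).const_mul C)).mono' ?_ (ae_of_all _ fun x => ?_)
  · have := h.continuous.measurable
    exact Measurable.aestronglyMeasurable (by fun_prop)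
  have hx := hC x
  have hx0 := norm_nonneg (h x)
  rw [Real.norm_eq_abs, abs_of_nonneg (by positivity)]
  simp only [Pi.add_apply, indicator, Metric.mem_ball, dist_zero_right, pow_one]
  split_ifs with h'
  · have : ‖x‖ ^ r * ‖h x‖ ^ 2 ≤ ‖x‖ ^ r * C ^ 2 := by gcongr
    have : 0 ≤ C * (‖h x‖ + ‖x‖ * ‖h x‖) := by positivity
    linarith
  · have h'' : ‖x‖ ^ r ≤ ‖x‖ := by
      simpa using Real.rpow_le_rpow_of_exponent_le (not_lt.1 h') hr1
    calc ‖x‖ ^ r * ‖h x‖ ^ 2 ≤ ‖x‖ * (C * ‖h x‖) := by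
          rw [sq]; gcongr
      _ ≤ C ^ 2 * 0 + C * (‖h x‖ + ‖x‖ * ‖h x‖) := by
          have := mul_nonneg hC0.le hx0
          nlinarith

/-! ### The Riesz energy on the Fourier side -/

/-- The kernel of `hat` has the sign of Mathlib's inverse Fourier transform. -/
lemma hat_eq_fourierInv (f : 𝓢(EuclideanSpace ℝ (Fin n), ℂ)) : hat f =
    ⇑(𝓕⁻ f : 𝓢(EuclideanSpace ℝ (Fin n), ℂ)) := by
  rw [SchwartzMap.fourierInv_coe]
  ext ξ
  rw [Real.fourierInv_eq', hat]
  refine integral_congr_ae (ae_of_all _ fun x => ?_)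
  simp only [smul_eq_mul]
  rw [real_inner_comm]
  push_cast
  congr 2
  ring

lemma integral_norm_sq_hat (f : 𝓢(EuclideanSpace ℝ (Fin n), ℂ)) :
    ∫ ξ, ‖hat f ξ‖ ^ 2 = ∫ x, ‖f x‖ ^ 2 := by
  rw [hat_eq_fourierInv, ← SchwartzMap.integral_norm_sq_fourier
    (𝓕⁻ f : 𝓢(EuclideanSpace ℝ (Fin n), ℂ))]
  simp

/-- The Gaussian `exp (-π t ‖ξ‖²)` has Fourier transform `heat t`. -/
lemma integral_exp_mul_cexp_inner {t : ℝ} (ht : 0 < t) (z : EuclideanSpace ℝ (Fin n)) :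
    ∫ ξ : EuclideanSpace ℝ (Fin n), ((Real.exp (-(π * ‖ξ‖ ^ 2 * t)) : ℝ) : ℂ) *
        Complex.exp (2 * (π : ℂ) * Complex.I * ((inner ℝ ξ z : ℝ) : ℂ)) =
      ((heat t z : ℝ) : ℂ) := by
  have hb : 0 < ((π * t : ℝ) : ℂ).re := by rw [Complex.ofReal_re]; positivity
  have h := GaussianFourier.integral_cexp_neg_mul_sq_norm_add hb (2 * (π : ℂ) * Complex.I) z
  have htC : (t : ℂ) ≠ 0 := by exact_mod_cast ht.ne'
  have hpC : (π : ℂ) ≠ 0 := by exact_mod_cast Real.pi_ne_zero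
  rw [finrank_euclideanSpace, Fintype.card_fin] at h
  convert h using 1
  · refine integral_congr_ae (ae_of_all _ fun ξ => ?_)
    simp only
    rw [Complex.ofReal_exp, ← Complex.exp_add, real_inner_comm]
    push_cast
    congr 1
    ring
  · rw [heat, Complex.ofReal_mul, Complex.ofReal_exp]
    congr 1
    · rw [show (π : ℂ) / ((π * t : ℝ) : ℂ) = ((t⁻¹ : ℝ) : ℂ) by push_cast; field_simp]
      rw [show ((n : ℂ) / 2) = (((n : ℝ) / 2 : ℝ) : ℂ) by push_cast; rfl,
        Real.rpow_neg ht.le, ← Real.inv_rpow ht.le, Complex.ofReal_cpow (by positivity)]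
    · push_cast
      congr 1
      rw [mul_pow, Complex.I_sq]
      field_simp
      ring

lemma integrable_mul_conj (f : 𝓢(EuclideanSpace ℝ (Fin n), ℂ)) :
    Integrable (fun p : EuclideanSpace ℝ (Fin n) × EuclideanSpace ℝ (Fin n) =>
      f p.1 * conj (f p.2)) (volume.prod volume) :=
  Integrable.mul_prod (f := f) (g := fun y => conj (f y)) f.integrable
    ((Complex.conjCLE : ℂ ≃L[ℝ] ℂ).toContinuousLinearMap.integrable_comp f.integrable)

/-- Plancherel's theorem for the heat energy of `f`, by Fubini from
`|f̂(ξ)|² = ∬ exp (2πi ξ·(x - y)) f(x) conj(f(y))`. -/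
lemma integral_gaussian_mul_norm_sq_hat (f : 𝓢(EuclideanSpace ℝ (Fin n), ℂ)) {t : ℝ}
    (ht : 0 < t) :
    ((∫ ξ, Real.exp (-(π * ‖ξ‖ ^ 2 * t)) * ‖hat f ξ‖ ^ 2 : ℝ) : ℂ) =
      ∫ p, ((heat t (p.1 - p.2) : ℝ) : ℂ) * (f p.1 * conj (f p.2))
        ∂((volume : Measure (EuclideanSpace ℝ (Fin n))).prod volume) := by
  set e : EuclideanSpace ℝ (Fin n) → EuclideanSpace ℝ (Fin n) → ℂ := fun ξ z =>
    Complex.exp (2 * (π : ℂ) * Complex.I * ((inner ℝ ξ z : ℝ) : ℂ)) with he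
  have hnorm : ∀ ξ z, ‖e ξ z‖ = 1 := fun ξ z => by
    simp only [he]
    rw [show 2 * (π : ℂ) * Complex.I * ((inner ℝ ξ z : ℝ) : ℂ) =
      ((2 * π * inner ℝ ξ z : ℝ) : ℂ) * Complex.I by push_cast; ring]
    exact Complex.norm_exp_ofReal_mul_I _
  have hconj : ∀ ξ z, conj (e ξ z) = e ξ (-z) := fun ξ z => by
    simp only [he, ← Complex.exp_conj, map_mul, Complex.conj_I, Complex.conj_ofReal, inner_neg_right,
      map_ofNat]
    congr 1
    push_cast
    ring
  have h1 : ∀ ξ, ((‖hat f ξ‖ ^ 2 : ℝ) : ℂ) =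
      ∫ p, e ξ (p.1 - p.2) * (f p.1 * conj (f p.2))
        ∂((volume : Measure (EuclideanSpace ℝ (Fin n))).prod volume) := by
    intro ξ
    have : ((‖hat f ξ‖ ^ 2 : ℝ) : ℂ) = hat f ξ * conj (hat f ξ) := by
      rw [Complex.mul_conj, Complex.normSq_eq_norm_sq]
    rw [this]
    have hc : conj (hat f ξ) = ∫ y, e ξ (-y) * conj (f y) := by
      rw [hat, ← integral_conj]
      refine integral_congr_ae (ae_of_all _ fun y => ?_)
      simp only [map_mul]
      rw [← hconj]
    rw [hc, hat, ← integral_prod_mul]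
    refine integral_congr_ae (ae_of_all _ fun p => ?_)
    have : e ξ (p.1 - p.2) = e ξ p.1 * e ξ (-p.2) := by
      simp only [he, ← Complex.exp_add, inner_sub_right, inner_neg_right]
      congr 1
      push_cast
      ring
    simp only [this]
    simp only [he]
    ring
  have hg : Integrable fun ξ : EuclideanSpace ℝ (Fin n) =>
      ((Real.exp (-(π * ‖ξ‖ ^ 2 * t)) : ℝ) : ℂ) := by
    suffices Integrable fun ξ : EuclideanSpace ℝ (Fin n) => Real.exp (-(π * ‖ξ‖ ^ 2 * t)) from
      this.ofReal
    refine Integrable.of_integral_ne_zero ?_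
    have : ∀ ξ : EuclideanSpace ℝ (Fin n), -(π * ‖ξ‖ ^ 2 * t) = -(π * t) * ‖ξ‖ ^ 2 :=
      fun ξ => by ring
    simp_rw [this]
    rw [GaussianFourier.integral_rexp_neg_mul_sq_norm (by positivity)]
    positivity
  have hcont : Continuous fun q : EuclideanSpace ℝ (Fin n) × EuclideanSpace ℝ (Fin n) =>
    e q.1 q.2 := by simp only [he]; fun_prop
  have hint : Integrable (Function.uncurry fun (ξ : EuclideanSpace ℝ (Fin n))
      (p : EuclideanSpace ℝ (Fin n) × EuclideanSpace ℝ (Fin n)) =>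
      ((Real.exp (-(π * ‖ξ‖ ^ 2 * t)) : ℝ) : ℂ) * (e ξ (p.1 - p.2) * (f p.1 * conj (f p.2))))
      (volume.prod (volume.prod volume)) := by
    have hm := hg.mul_prod (integrable_mul_conj f)
    refine hm.mono ?_ (ae_of_all _ fun q => ?_)
    · have := f.continuous
      have h3 : Continuous fun q : EuclideanSpace ℝ (Fin n) ×
        EuclideanSpace ℝ (Fin n) × EuclideanSpace ℝ (Fin n) => e q.1 (q.2.1 - q.2.2) :=
        hcont.comp (by fun_prop : Continuous fun q : EuclideanSpace ℝ (Fin n) ×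
        EuclideanSpace ℝ (Fin n) × EuclideanSpace ℝ (Fin n) => (q.1, q.2.1 - q.2.2))
      refine Continuous.aestronglyMeasurable ?_
      simp only [Function.uncurry_def]
      fun_prop
    · simp only [Function.uncurry_def, norm_mul, hnorm, one_mul, le_refl]
  calc ((∫ ξ, Real.exp (-(π * ‖ξ‖ ^ 2 * t)) * ‖hat f ξ‖ ^ 2 : ℝ) : ℂ)
      = ∫ ξ, ∫ p, ((Real.exp (-(π * ‖ξ‖ ^ 2 * t)) : ℝ) : ℂ) *
          (e ξ (p.1 - p.2) * (f p.1 * conj (f p.2)))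
          ∂((volume : Measure (EuclideanSpace ℝ (Fin n))).prod volume) := by
        rw [← integral_complex_ofReal]
        refine integral_congr_ae (ae_of_all _ fun ξ => ?_)
        simp only
        rw [integral_const_mul, ← h1, Complex.ofReal_mul]
    _ = _ := by
        rw [integral_integral_swap hint]
        refine integral_congr_ae (ae_of_all _ fun p => ?_)
        simp only [← mul_assoc]
        rw [integral_mul_const, integral_mul_const, integral_exp_mul_cexp_inner ht]

lemma ae_fst_ne_snd (hn : 1 ≤ n) :
    ∀ᵐ p ∂((volume : Measure (EuclideanSpace ℝ (Fin n))).prod volume), p.1 ≠ p.2 := by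
  have : Nonempty (Fin n) := ⟨⟨0, hn⟩⟩
  have hms : MeasurableSet {p : EuclideanSpace ℝ (Fin n) × EuclideanSpace ℝ (Fin n) |
      p.1 ≠ p.2} := (measurableSet_eq_fun measurable_fst measurable_snd).compl
  rw [Measure.ae_prod_iff_ae_ae hms]
  exact ae_of_all _ fun x => (Measure.ae_ne volume x).mono fun y hy => hy.symm

/-- Plancherel's theorem for the Riesz energy of `f`, obtained by integrating the one for the heat
energy against `t^(a-1) dt`. -/
lemma integral_rpow_mul_norm_sq_hat (hn : 1 ≤ n) (f : 𝓢(EuclideanSpace ℝ (Fin n), ℂ)) {a : ℝ}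
    (ha : 0 < a) (ha' : a < 1 / 2)
    (hint : Integrable (fun p : EuclideanSpace ℝ (Fin n) × EuclideanSpace ℝ (Fin n) =>
      ((riesz a (p.1 - p.2) : ℝ) : ℂ) * (f p.1 * conj (f p.2))) (volume.prod volume)) :
    ((∫ ξ, (π * ‖ξ‖ ^ 2) ^ (-a) * ‖hat f ξ‖ ^ 2 : ℝ) : ℂ) =
      ∫ p, ((riesz a (p.1 - p.2) : ℝ) : ℂ) * (f p.1 * conj (f p.2))
        ∂((volume : Measure (EuclideanSpace ℝ (Fin n))).prod volume) := by
  have : Nonempty (Fin n) := ⟨⟨0, hn⟩⟩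
  have hn' : (1 : ℝ) ≤ n := by exact_mod_cast hn
  have han : a < (n : ℝ) / 2 := by linarith
  have hG := Real.Gamma_pos_of_pos ha
  have hGn := Real.Gamma_pos_of_pos (sub_pos.2 han)
  set μ := (volume : Measure ℝ).restrict (Ioi 0) with hμ
  have hcont : Continuous (hat (⇑f)) := by rw [hat_eq_fourierInv]; exact SchwartzMap.continuous _
  -- the integral in `t` on the Fourier side
  have hspec : ∀ ξ : EuclideanSpace ℝ (Fin n), ξ ≠ 0 →
      ∫ t, t ^ (a - 1) * Real.exp (-(π * ‖ξ‖ ^ 2 * t)) ∂μ =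
        Real.Gamma a * (π * ‖ξ‖ ^ 2) ^ (-a) := by
    intro ξ hξ
    have : 0 < ‖ξ‖ := norm_pos_iff.2 hξ
    rw [Real.integral_rpow_mul_exp_neg_mul_Ioi ha (by positivity), one_div,
      Real.inv_rpow (by positivity), Real.rpow_neg (by positivity), mul_comm]
  have hS : Integrable fun ξ => (π * ‖ξ‖ ^ 2) ^ (-a) * ‖hat f ξ‖ ^ 2 := by
    have h := (integrable_norm_rpow_mul_sq hn (𝓕⁻ f) (r := -(2 * a)) (by linarith)
      (by linarith)).const_mul (π ^ (-a))
    refine h.congr (ae_of_all _ fun ξ => ?_)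
    simp only
    rw [← hat_eq_fourierInv, Real.mul_rpow Real.pi_pos.le (by positivity), ← Real.rpow_natCast,
      ← Real.rpow_natCast, ← Real.rpow_mul (norm_nonneg _), mul_assoc]
    congr 4
    push_cast; ring
  have hI1 : Integrable (Function.uncurry fun (ξ : EuclideanSpace ℝ (Fin n)) (t : ℝ) =>
      t ^ (a - 1) * Real.exp (-(π * ‖ξ‖ ^ 2 * t)) * ‖hat f ξ‖ ^ 2) (volume.prod μ) := by
    rw [integrable_prod_iff]
    · constructor
      · filter_upwards [Measure.ae_ne volume 0] with ξ hξ
        have : 0 < ‖ξ‖ := norm_pos_iff.2 hξ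
        have hi : Integrable (fun t => t ^ (a - 1) * Real.exp (-(π * ‖ξ‖ ^ 2 * t))) μ :=
          Integrable.of_integral_ne_zero (by rw [hspec ξ hξ]; positivity)
        simpa only [Function.uncurry_apply_pair] using hi.mul_const (‖hat f ξ‖ ^ 2)
      · refine (hS.const_mul (Real.Gamma a)).congr ?_
        filter_upwards [Measure.ae_ne volume 0] with ξ hξ
        rw [← mul_assoc, ← hspec ξ hξ, ← integral_mul_const]
        refine setIntegral_congr_fun measurableSet_Ioi fun t (ht : 0 < t) => ?_
        simp only [Function.uncurry_apply_pair]
        rw [Real.norm_of_nonneg (by positivity)]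
    · have := hcont.measurable
      refine Measurable.aestronglyMeasurable ?_
      simp only [Function.uncurry_def]
      fun_prop
  have hL : ∫ t, t ^ (a - 1) * ∫ ξ : EuclideanSpace ℝ (Fin n),
        Real.exp (-(π * ‖ξ‖ ^ 2 * t)) * ‖hat f ξ‖ ^ 2 ∂volume ∂μ =
      Real.Gamma a * ∫ ξ, (π * ‖ξ‖ ^ 2) ^ (-a) * ‖hat f ξ‖ ^ 2 := by
    simp_rw [← integral_const_mul, ← mul_assoc]
    rw [← integral_integral_swap hI1]
    refine integral_congr_ae ?_
    filter_upwards [Measure.ae_ne volume 0] with ξ hξ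
    rw [integral_mul_const, hspec ξ hξ]
  -- the integral in `t` on the side of `f`
  have hheat : ∀ z : EuclideanSpace ℝ (Fin n), z ≠ 0 →
      ∫ t, t ^ (a - 1) * heat t z ∂μ = Real.Gamma a * riesz a z := by
    intro z hz
    rw [integral_rpow_mul_heat han hz, riesz]
    field_simp
  have hI2 : Integrable (Function.uncurry fun (p : EuclideanSpace ℝ (Fin n) ×
      EuclideanSpace ℝ (Fin n)) (t : ℝ) =>
      ((t ^ (a - 1) * heat t (p.1 - p.2) : ℝ) : ℂ) * (f p.1 * conj (f p.2)))
      ((volume.prod volume).prod μ) := by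
    rw [integrable_prod_iff]
    · constructor
      · filter_upwards [ae_fst_ne_snd hn] with p hp
        have hz : 0 < ‖p.1 - p.2‖ := norm_pos_iff.2 (sub_ne_zero.2 hp)
        have hi : Integrable (fun t => t ^ (a - 1) * heat t (p.1 - p.2)) μ :=
          Integrable.of_integral_ne_zero (by
            rw [hheat _ (sub_ne_zero.2 hp), riesz]; positivity)
        have hi' : Integrable (fun t => ((t ^ (a - 1) * heat t (p.1 - p.2) : ℝ) : ℂ)) μ :=
          hi.ofReal
        simpa only [Function.uncurry_apply_pair] using hi'.mul_const (f p.1 * conj (f p.2))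
      · refine (hint.norm.const_mul (Real.Gamma a)).congr ?_
        filter_upwards [ae_fst_ne_snd hn] with p hp
        have h1 : ∀ t ∈ Ioi (0 : ℝ), ‖((t ^ (a - 1) * heat t (p.1 - p.2) : ℝ) : ℂ) *
            (f p.1 * conj (f p.2))‖ =
            t ^ (a - 1) * heat t (p.1 - p.2) * ‖f p.1 * conj (f p.2)‖ := by
          intro t ht
          have ht : 0 < t := ht
          have := heat_pos ht (p.1 - p.2)
          rw [norm_mul, Complex.norm_real, Real.norm_of_nonneg (by positivity)]
        simp only [Function.uncurry_apply_pair]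
        rw [hμ, setIntegral_congr_fun measurableSet_Ioi h1, integral_mul_const, ← hμ,
          hheat _ (sub_ne_zero.2 hp), norm_mul, Complex.norm_real,
          Real.norm_of_nonneg (riesz_nonneg ha han _), mul_assoc]
    · have h0 := f.continuous.measurable
      have h1 : Measurable fun q : (EuclideanSpace ℝ (Fin n) × EuclideanSpace ℝ (Fin n)) × ℝ =>
          heat q.2 (q.1.1 - q.1.2) :=
        measurable_heat.comp (measurable_snd.prodMk
          ((measurable_fst.comp measurable_fst).sub (measurable_snd.comp measurable_fst)))
      have h2 : Measurable fun q : (EuclideanSpace ℝ (Fin n) × EuclideanSpace ℝ (Fin n)) × ℝ =>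
          conj (f q.1.2) :=
        Complex.continuous_conj.measurable.comp
          (h0.comp (measurable_snd.comp measurable_fst))
      refine Measurable.aestronglyMeasurable ?_
      simp only [Function.uncurry_def]
      fun_prop
  have hR : ∫ t, ((t ^ (a - 1) : ℝ) : ℂ) *
      ∫ p, ((heat t (p.1 - p.2) : ℝ) : ℂ) * (f p.1 * conj (f p.2)) ∂(volume.prod volume) ∂μ =
      Real.Gamma a * ∫ p, ((riesz a (p.1 - p.2) : ℝ) : ℂ) * (f p.1 * conj (f p.2))
        ∂((volume : Measure (EuclideanSpace ℝ (Fin n))).prod volume) := by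
    simp_rw [← integral_const_mul, ← mul_assoc, ← Complex.ofReal_mul]
    simp_rw [← mul_assoc] at hI2
    rw [← integral_integral_swap hI2]
    refine integral_congr_ae ?_
    filter_upwards [ae_fst_ne_snd hn] with p hp
    rw [integral_mul_const, integral_mul_const, integral_complex_ofReal,
      hheat _ (sub_ne_zero.2 hp)]
  have hG' : ((Real.Gamma a : ℝ) : ℂ) ≠ 0 := by exact_mod_cast hG.ne'
  apply mul_left_cancel₀ hG'
  rw [← hR, ← Complex.ofReal_mul, ← hL, ← integral_complex_ofReal]
  refine setIntegral_congr_fun measurableSet_Ioi fun t ht => ?_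
  rw [Complex.ofReal_mul, integral_gaussian_mul_norm_sq_hat f ht]

/-! ### The ground state representation -/

lemma integrable_and_integral_of_lintegral {α : Type*} [MeasurableSpace α] {μ : Measure α}
    {f : α → ℝ} {c : ℝ} (hf : AEStronglyMeasurable f μ) (h0 : 0 ≤ᵐ[μ] f) (hc : 0 ≤ c)
    (h : ∫⁻ x, ENNReal.ofReal (f x) ∂μ = ENNReal.ofReal c) :
    Integrable f μ ∧ ∫ x, f x ∂μ = c := by
  constructor
  · refine ⟨hf, ?_⟩
    rw [hasFiniteIntegral_iff_ofReal h0, h]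
    exact ENNReal.ofReal_lt_top
  · rw [integral_eq_lintegral_of_nonneg_ae h0 hf, h, ENNReal.toReal_ofReal hc]

/-- The factor `π^a Γ(n/4 - a) / Γ(n/4 + a)` by which convolution with `riesz a` multiplies
`‖x‖^(-n/2)`, apart from the power `‖x‖^(2a)`. -/
noncomputable def pittFactor (n : ℕ) (a : ℝ) : ℝ :=
  π ^ a * (Real.Gamma ((n : ℝ) / 4 - a) / Real.Gamma ((n : ℝ) / 4 + a))

/-- The semigroup law of the Riesz kernels applied to `‖y‖^(-n/2) = π^(n/4) riesz (n/4) y`. -/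
lemma integral_riesz_mul_norm_rpow (hn : 1 ≤ n) {a : ℝ} (ha : 0 < a) (han : a < (n : ℝ) / 4)
    {x : EuclideanSpace ℝ (Fin n)} (hx : x ≠ 0) :
    Integrable (fun y => riesz a (x - y) * ‖y‖ ^ (-((n : ℝ) / 2))) ∧
    ∫ y, riesz a (x - y) * ‖y‖ ^ (-((n : ℝ) / 2)) =
      pittFactor n a * (‖x‖ ^ (2 * a) * ‖x‖ ^ (-((n : ℝ) / 2))) := by
  have hx' : 0 < ‖x‖ := norm_pos_iff.2 hx
  have hc : 0 < (n : ℝ) / 4 := ha.trans han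
  have hG := Real.Gamma_pos_of_pos hc
  have hG1 := Real.Gamma_pos_of_pos (sub_pos.2 han)
  have hG2 := Real.Gamma_pos_of_pos (add_pos hc ha)
  have hy : ∀ y : EuclideanSpace ℝ (Fin n), riesz a (x - y) * ‖y‖ ^ (-((n : ℝ) / 2)) =
      π ^ ((n : ℝ) / 4) * (riesz a (x - y) * riesz ((n : ℝ) / 4) y) := by
    intro y
    have : riesz ((n : ℝ) / 4) y = π ^ (-((n : ℝ) / 4)) * ‖y‖ ^ (-((n : ℝ) / 2)) := by
      rw [riesz, show (n : ℝ) / 2 - n / 4 = n / 4 by ring, div_self hG.ne', one_mul,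
        Real.mul_rpow Real.pi_pos.le (by positivity), ← Real.rpow_natCast,
        ← Real.rpow_mul (norm_nonneg _)]
      congr 2 <;> (push_cast; ring)
    have hp : π ^ ((n : ℝ) / 4) * π ^ (-((n : ℝ) / 4)) = 1 := by
      rw [← Real.rpow_add Real.pi_pos, add_neg_cancel, Real.rpow_zero]
    rw [this]
    linear_combination (-(riesz a (x - y) * ‖y‖ ^ (-((n : ℝ) / 2)))) * hp
  have hx2 : pittFactor n a * (‖x‖ ^ (2 * a) * ‖x‖ ^ (-((n : ℝ) / 2))) =
      π ^ ((n : ℝ) / 4) * riesz (a + (n : ℝ) / 4) x := by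
    rw [riesz, pittFactor, Real.mul_rpow Real.pi_pos.le (by positivity),
      ← Real.rpow_natCast ‖x‖, ← Real.rpow_mul (norm_nonneg _), ← Real.rpow_add hx',
      show (n : ℝ) / 2 - (a + n / 4) = n / 4 - a by ring, add_comm a]
    have hp : π ^ a = π ^ ((n : ℝ) / 4) * π ^ ((n : ℝ) / 4 + a - n / 2) := by
      rw [← Real.rpow_add Real.pi_pos]; congr 1; ring
    rw [hp, show ((2 : ℕ) : ℝ) * ((n : ℝ) / 4 + a - n / 2) = 2 * a + -((n : ℝ) / 2) by
      push_cast; ring]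
    ring
  have hrn := fun y : EuclideanSpace ℝ (Fin n) =>
    riesz_nonneg ha (by linarith : a < (n : ℝ) / 2) (x - y)
  refine integrable_and_integral_of_lintegral ?_ (ae_of_all _ fun y => ?_) ?_ ?_
  · have := measurable_riesz (n := n) a
    exact Measurable.aestronglyMeasurable (by fun_prop)
  · exact mul_nonneg (hrn y) (by positivity)
  · unfold pittFactor; positivity
  · simp_rw [hy, hx2, ENNReal.ofReal_mul (show 0 ≤ π ^ ((n : ℝ) / 4) by positivity)]
    rw [lintegral_const_mul' _ _ ENNReal.ofReal_ne_top,
      lintegral_riesz_mul_riesz hn ha hc (by linarith) hx]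

/-- The pointwise identity behind the ground state representation, with `A = |x|^(n/2)`,
`B = |y|^(n/2)`, `z = f x` and `w = f y`. -/
lemma norm_sub_sq_weighted {A B : ℝ} (hA : 0 < A) (hB : 0 < B) (z w : ℂ) :
    ‖(A : ℂ) * z - (B : ℂ) * w‖ ^ 2 * (A⁻¹ * B⁻¹) =
      ‖z‖ ^ 2 * A * B⁻¹ + ‖w‖ ^ 2 * B * A⁻¹ - 2 * (z * conj w).re := by
  have h1 : ‖(A : ℂ) * z - (B : ℂ) * w‖ ^ 2 =
      A ^ 2 * ‖z‖ ^ 2 + B ^ 2 * ‖w‖ ^ 2 - 2 * (A * B * (z * conj w).re) := by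
    simp only [← Complex.normSq_eq_norm_sq, Complex.normSq_apply]
    simp
    ring
  rw [h1]
  field_simp

lemma ae_ne_zero_prod (hn : 1 ≤ n) :
    ∀ᵐ p ∂((volume : Measure (EuclideanSpace ℝ (Fin n))).prod
      (volume : Measure (EuclideanSpace ℝ (Fin n)))), p.1 ≠ 0 ∧ p.2 ≠ 0 := by
  have : Nonempty (Fin n) := ⟨⟨0, hn⟩⟩
  have h : ∀ᵐ x : EuclideanSpace ℝ (Fin n), x ≠ 0 := Measure.ae_ne volume 0
  exact (Measure.quasiMeasurePreserving_fst.ae h).and (Measure.quasiMeasurePreserving_snd.ae h)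

/-- The integrand of the Besov energy with the kernel `|x - y|⁻ⁿ` replaced by a Riesz kernel. -/
noncomputable def rieszIntegrand (a : ℝ) (g : EuclideanSpace ℝ (Fin n) → ℂ)
    (p : EuclideanSpace ℝ (Fin n) × EuclideanSpace ℝ (Fin n)) : ℝ :=
  riesz a (p.1 - p.2) * (‖g p.1 - g p.2‖ ^ 2 *
    (‖p.1‖ ^ (-((n : ℝ) / 2)) * ‖p.2‖ ^ (-((n : ℝ) / 2))))

/-- The Riesz energy of `f` equals a moment of `|f|²` minus a quadratic form in the differences
`g(x) - g(y)`. Its diagonal part `T` is integrable with an explicit integral, and dominates the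
mixed term, which gives all the integrability that is needed. -/
lemma ground_state (hn : 1 ≤ n) (f : 𝓢(EuclideanSpace ℝ (Fin n), ℂ)) {a : ℝ}
    (ha : 0 < a) (ha' : a < 1 / 4) :
    Integrable (rieszIntegrand a (weighted f)) (volume.prod volume) ∧
    ∫ ξ, (π * ‖ξ‖ ^ 2) ^ (-a) * ‖hat f ξ‖ ^ 2 =
      pittFactor n a * (∫ x : EuclideanSpace ℝ (Fin n), ‖x‖ ^ (2 * a) * ‖f x‖ ^ 2) -
      1 / 2 * ∫ p, rieszIntegrand a (weighted f) p
        ∂((volume : Measure (EuclideanSpace ℝ (Fin n))).prod volume) := by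
  have : Nonempty (Fin n) := ⟨⟨0, hn⟩⟩
  have hn' : (1 : ℝ) ≤ n := by exact_mod_cast hn
  have han : a < (n : ℝ) / 4 := by linarith
  have hk := riesz_nonneg ha (by linarith : a < (n : ℝ) / 2)
  have hmr := measurable_riesz (n := n) a
  have hmf := f.continuous.measurable
  set T : EuclideanSpace ℝ (Fin n) × EuclideanSpace ℝ (Fin n) → ℝ := fun p =>
    ‖f p.1‖ ^ 2 * ‖p.1‖ ^ ((n : ℝ) / 2) * (riesz a (p.1 - p.2) * ‖p.2‖ ^ (-((n : ℝ) / 2)))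
    with hTdef
  have hT0 : ∀ p, 0 ≤ T p := fun p => by
    have := hk (p.1 - p.2)
    simp only [hTdef]; positivity
  have hinner : ∀ᵐ x : EuclideanSpace ℝ (Fin n),
      ∫ y, T (x, y) = pittFactor n a * (‖x‖ ^ (2 * a) * ‖f x‖ ^ 2) := by
    filter_upwards [Measure.ae_ne volume 0] with x hx
    have hx' : 0 < ‖x‖ := norm_pos_iff.2 hx
    simp only [hTdef]
    rw [integral_const_mul, (integral_riesz_mul_norm_rpow hn ha han hx).2]
    have : ‖x‖ ^ ((n : ℝ) / 2) * ‖x‖ ^ (-((n : ℝ) / 2)) = 1 := by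
      rw [← Real.rpow_add hx', add_neg_cancel, Real.rpow_zero]
    linear_combination (pittFactor n a * (‖x‖ ^ (2 * a) * ‖f x‖ ^ 2)) * this
  have hTi : Integrable T (volume.prod volume) := by
    rw [integrable_prod_iff]
    · constructor
      · filter_upwards [Measure.ae_ne volume 0] with x hx
        exact (integral_riesz_mul_norm_rpow hn ha han hx).1.const_mul
          (‖f x‖ ^ 2 * ‖x‖ ^ ((n : ℝ) / 2))
      · simp_rw [Real.norm_of_nonneg (hT0 _)]
        exact ((integrable_norm_rpow_mul_sq hn f (r := 2 * a) (by linarith)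
          (by linarith)).const_mul _).congr (hinner.mono fun x hx => hx.symm)
    · exact Measurable.aestronglyMeasurable (by simp only [hTdef]; fun_prop)
  have hTint : ∫ p, T p ∂(volume.prod volume) =
      pittFactor n a * (∫ x : EuclideanSpace ℝ (Fin n), ‖x‖ ^ (2 * a) * ‖f x‖ ^ 2) := by
    rw [integral_prod _ hTi, integral_congr_ae hinner, integral_const_mul]
  have hTs : Integrable (fun p => T p.swap) (volume.prod volume) := hTi.swap
  have hTsint : ∫ p, T p.swap ∂(volume.prod volume) =
      pittFactor n a * (∫ x : EuclideanSpace ℝ (Fin n), ‖x‖ ^ (2 * a) * ‖f x‖ ^ 2) := by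
    rw [integral_prod_swap, hTint]
  have hpt : ∀ᵐ p ∂((volume : Measure (EuclideanSpace ℝ (Fin n))).prod volume),
      rieszIntegrand a (weighted f) p = T p + T p.swap -
        2 * (((riesz a (p.1 - p.2) : ℝ) : ℂ) * (f p.1 * conj (f p.2))).re := by
    filter_upwards [ae_ne_zero_prod hn] with p hp
    have h1 : 0 < ‖p.1‖ := norm_pos_iff.2 hp.1
    have h2 : 0 < ‖p.2‖ := norm_pos_iff.2 hp.2
    simp only [rieszIntegrand, weighted, hTdef, Prod.fst_swap, Prod.snd_swap]
    rw [← neg_sub p.1 p.2, riesz_neg, Real.rpow_neg h1.le, Real.rpow_neg h2.le,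
      norm_sub_sq_weighted (by positivity) (by positivity), Complex.re_ofReal_mul]
    ring
  have hkff : Integrable (fun p : EuclideanSpace ℝ (Fin n) × EuclideanSpace ℝ (Fin n) =>
      ((riesz a (p.1 - p.2) : ℝ) : ℂ) * (f p.1 * conj (f p.2))) (volume.prod volume) := by
    refine (hTi.add hTs).mono' ?_ ?_
    · have h2 : Measurable fun q : EuclideanSpace ℝ (Fin n) × EuclideanSpace ℝ (Fin n) =>
          conj (f q.2) := Complex.continuous_conj.measurable.comp (hmf.comp measurable_snd)
      exact Measurable.aestronglyMeasurable (by fun_prop)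
    · filter_upwards [ae_ne_zero_prod hn] with p hp
      have h1 : 0 < ‖p.1‖ := norm_pos_iff.2 hp.1
      have h2 : 0 < ‖p.2‖ := norm_pos_iff.2 hp.2
      have hA : 0 < ‖p.1‖ ^ ((n : ℝ) / 2) := by positivity
      have hB : 0 < ‖p.2‖ ^ ((n : ℝ) / 2) := by positivity
      simp only [Pi.add_apply, hTdef, Prod.fst_swap, Prod.snd_swap]
      rw [← neg_sub p.1 p.2, riesz_neg, Real.rpow_neg h1.le, Real.rpow_neg h2.le, norm_mul,
        norm_mul, Complex.norm_real, Real.norm_of_nonneg (hk _), RCLike.norm_conj]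
      -- the arithmetic-geometric mean inequality, read off from the same identity for `‖f‖`
      have key := norm_sub_sq_weighted hA hB (‖f p.1‖ : ℂ) (‖f p.2‖ : ℂ)
      have hn0 : 0 ≤ ‖((‖p.1‖ ^ ((n : ℝ) / 2) : ℝ) : ℂ) * (‖f p.1‖ : ℂ) -
        ((‖p.2‖ ^ ((n : ℝ) / 2) : ℝ) : ℂ) * (‖f p.2‖ : ℂ)‖ ^ 2 *
        ((‖p.1‖ ^ ((n : ℝ) / 2))⁻¹ * (‖p.2‖ ^ ((n : ℝ) / 2))⁻¹) := by positivity
      rw [key, Complex.conj_ofReal, ← Complex.ofReal_mul, Complex.ofReal_re, Complex.norm_real,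
        Complex.norm_real, norm_norm, norm_norm] at hn0
      have hle : ‖f p.1‖ * ‖f p.2‖ ≤
          ‖f p.1‖ ^ 2 * ‖p.1‖ ^ ((n : ℝ) / 2) * (‖p.2‖ ^ ((n : ℝ) / 2))⁻¹ +
          ‖f p.2‖ ^ 2 * ‖p.2‖ ^ ((n : ℝ) / 2) * (‖p.1‖ ^ ((n : ℝ) / 2))⁻¹ := by
        have : 0 ≤ ‖f p.1‖ * ‖f p.2‖ := by positivity
        linarith
      have := mul_le_mul_of_nonneg_left hle (hk (p.1 - p.2))
      linarith
  have hre : Integrable (fun p : EuclideanSpace ℝ (Fin n) × EuclideanSpace ℝ (Fin n) =>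
      (((riesz a (p.1 - p.2) : ℝ) : ℂ) * (f p.1 * conj (f p.2))).re) (volume.prod volume) :=
    hkff.re
  have hE := congrArg Complex.re (integral_rpow_mul_norm_sq_hat hn f ha (by linarith) hkff)
  have hre' : (∫ p, ((riesz a (p.1 - p.2) : ℝ) : ℂ) * (f p.1 * conj (f p.2))
        ∂((volume : Measure (EuclideanSpace ℝ (Fin n))).prod volume)).re =
      ∫ p, (((riesz a (p.1 - p.2) : ℝ) : ℂ) * (f p.1 * conj (f p.2))).re
        ∂((volume : Measure (EuclideanSpace ℝ (Fin n))).prod volume) := (integral_re hkff).symm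
  rw [Complex.ofReal_re, hre'] at hE
  refine ⟨(((hTi.add hTs).sub (hre.const_mul 2))).congr (hpt.mono fun p hp => hp.symm), ?_⟩
  have hTadd : Integrable (fun p => T p + T p.swap) (volume.prod volume) := hTi.add hTs
  rw [integral_congr_ae hpt, integral_sub hTadd (hre.const_mul 2), integral_add hTi hTs,
    hTint, hTsint, integral_const_mul, hE]
  ring

/-! ### Differentiating the moments -/

lemma rpow_le_rpow_add_rpow_neg {r s ε : ℝ} (hr : 0 < r) (hs : |s| ≤ ε) :
    r ^ s ≤ r ^ ε + r ^ (-ε) := by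
  rw [abs_le] at hs
  rcases le_total 1 r with h | h
  · have := Real.rpow_le_rpow_of_exponent_le h hs.2
    have := Real.rpow_nonneg hr.le (-ε)
    linarith
  · have := Real.rpow_le_rpow_of_exponent_ge hr h hs.1
    have := Real.rpow_nonneg hr.le ε
    linarith

lemma abs_log_le_rpow {r ε : ℝ} (hr : 0 < r) (hε : 0 < ε) :
    |Real.log r| ≤ (r ^ ε + r ^ (-ε)) / ε := by
  have h1 := Real.log_le_rpow_div hr.le hε
  have h2 := Real.log_le_rpow_div (inv_pos.2 hr).le hε
  rw [Real.log_inv, Real.inv_rpow hr.le, ← Real.rpow_neg hr.le] at h2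
  have h3 : 0 ≤ r ^ ε / ε := by positivity
  have h4 : 0 ≤ r ^ (-ε) / ε := by positivity
  rw [abs_le, add_div]
  constructor <;> linarith

/-- The moments `∫ ‖x‖^(2a) |h|²` are differentiable at `a = 0`. The derivative of the integrand is
dominated for `|a| < 1/8` by a combination of the moments with exponents `±1/2` and `0`, which are
finite in every dimension `n ≥ 1`. -/
lemma hasDerivAt_integral_norm_rpow (hn : 1 ≤ n) (h : 𝓢(EuclideanSpace ℝ (Fin n), ℂ)) :
    Integrable (fun x : EuclideanSpace ℝ (Fin n) => Real.log ‖x‖ * ‖h x‖ ^ 2) ∧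
    HasDerivAt (fun a : ℝ => ∫ x : EuclideanSpace ℝ (Fin n), ‖x‖ ^ (2 * a) * ‖h x‖ ^ 2)
      (2 * ∫ x : EuclideanSpace ℝ (Fin n), Real.log ‖x‖ * ‖h x‖ ^ 2) 0 := by
  have : Nonempty (Fin n) := ⟨⟨0, hn⟩⟩
  have hmh := h.continuous.measurable
  have hS := fun r (h1 : (-1 : ℝ) < r) (h2 : r ≤ 1) => integrable_norm_rpow_mul_sq hn h h1 h2
  have hbound := (((hS (1 / 2) (by norm_num) (by norm_num)).add
    ((hS 0 (by norm_num) (by norm_num)).const_mul 2)).add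
    (hS (-(1 / 2)) (by norm_num) (by norm_num))).const_mul 8
  have key := hasDerivAt_integral_of_dominated_loc_of_deriv_le
    (μ := (volume : Measure (EuclideanSpace ℝ (Fin n))))
    (F := fun (a : ℝ) x => ‖x‖ ^ (2 * a) * ‖h x‖ ^ 2)
    (F' := fun (a : ℝ) x => ‖x‖ ^ (2 * a) * Real.log ‖x‖ * 2 * ‖h x‖ ^ 2)
    (x₀ := (0 : ℝ)) (Metric.ball_mem_nhds (0 : ℝ) (ε := 1 / 8) (by norm_num))
    (Eventually.of_forall fun a => Measurable.aestronglyMeasurable (by fun_prop))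
    (hS _ (by norm_num) (by norm_num)) (Measurable.aestronglyMeasurable (by fun_prop)) ?_ hbound ?_
  · have he : ∀ x : EuclideanSpace ℝ (Fin n),
        ‖x‖ ^ (2 * (0 : ℝ)) * Real.log ‖x‖ * 2 * ‖h x‖ ^ 2 =
          2 * (Real.log ‖x‖ * ‖h x‖ ^ 2) := fun x => by
      rw [mul_zero, Real.rpow_zero]; ring
    simp_rw [he] at key
    refine ⟨?_, ?_⟩
    · simpa [← mul_assoc] using key.1.const_mul (1 / 2)
    · rw [← integral_const_mul]; exact key.2
  · filter_upwards [Measure.ae_ne volume 0] with x hx a ha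
    have hx' : 0 < ‖x‖ := norm_pos_iff.2 hx
    rw [Metric.mem_ball, dist_zero_right, Real.norm_eq_abs] at ha
    have h1 := rpow_le_rpow_add_rpow_neg (s := 2 * a) (ε := 1 / 4) hx' (by
      rw [abs_mul, abs_two]; linarith)
    have h2 := abs_log_le_rpow hx' (show (0 : ℝ) < 1 / 4 by norm_num)
    have h3 : ‖x‖ ^ (2 * a) * |Real.log ‖x‖| ≤
        4 * (‖x‖ ^ (1 / 2 : ℝ) + 2 * ‖x‖ ^ (0 : ℝ) + ‖x‖ ^ (-(1 / 2) : ℝ)) := by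
      calc _ ≤ (‖x‖ ^ (1 / 4 : ℝ) + ‖x‖ ^ (-(1 / 4) : ℝ)) *
            ((‖x‖ ^ (1 / 4 : ℝ) + ‖x‖ ^ (-(1 / 4) : ℝ)) / (1 / 4)) := by gcongr
        _ = _ := by
          rw [show (1 / 2 : ℝ) = 1 / 4 + 1 / 4 by norm_num, Real.rpow_add hx',
            show (0 : ℝ) = 1 / 4 + -(1 / 4) by norm_num, Real.rpow_add hx',
            show -(1 / 4 + 1 / 4 : ℝ) = -(1 / 4) + -(1 / 4) by norm_num, Real.rpow_add hx']
          ring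
    simp only [Pi.add_apply]
    rw [norm_mul, norm_mul, norm_mul, norm_pow, norm_norm, Real.norm_eq_abs (Real.log _),
      Real.norm_of_nonneg (show 0 ≤ ‖x‖ ^ (2 * a) by positivity), Real.norm_two]
    have := mul_le_mul_of_nonneg_right h3 (show 0 ≤ 2 * ‖h x‖ ^ 2 by positivity)
    linarith
  · filter_upwards [Measure.ae_ne volume 0] with x hx a ha
    have hx' : 0 < ‖x‖ := norm_pos_iff.2 hx
    have h2 : HasDerivAt (fun a : ℝ => 2 * a) 2 a := by
      simpa using (hasDerivAt_id a).const_mul (2 : ℝ)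
    have := (h2.const_rpow hx').mul_const (‖h x‖ ^ 2)
    refine this.congr_deriv ?_
    ring

/-! ### The limit `a → 0` -/

lemma hasDerivAt_pittFactor (hn : 1 ≤ n) :
    HasDerivAt (pittFactor n) (Real.log π - 2 * psi ((n : ℝ) / 4)) 0 := by
  have hn' : (1 : ℝ) ≤ n := by exact_mod_cast hn
  set c : ℝ := (n : ℝ) / 4 with hc
  have hc0 : 0 < c := by positivity
  have hG := (Real.Gamma_pos_of_pos hc0).ne'
  have hd : HasDerivAt Real.Gamma (deriv Real.Gamma c) c :=
    (Real.differentiableAt_Gamma fun m => by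
      have : (0 : ℝ) ≤ m := Nat.cast_nonneg m
      linarith).hasDerivAt
  have hpsi : psi c = deriv Real.Gamma c / Real.Gamma c := (hd.log hG).deriv
  have h1 : HasDerivAt (fun a : ℝ => Real.Gamma (c - a)) (-deriv Real.Gamma c) 0 := by
    exact HasDerivAt.comp_const_sub c 0 (by rwa [sub_zero])
  have h2 : HasDerivAt (fun a : ℝ => Real.Gamma (c + a)) (deriv Real.Gamma c) 0 :=
    HasDerivAt.comp_const_add c 0 (by rwa [add_zero])
  have h3 : HasDerivAt (fun a : ℝ => π ^ a) (Real.log π) 0 := by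
    simpa using (hasDerivAt_id (0 : ℝ)).const_rpow Real.pi_pos
  have h4 := h3.mul (h1.div h2 (by simpa using hG))
  refine h4.congr_deriv ?_
  simp only [Pi.div_apply, add_zero, sub_zero, Real.rpow_zero]
  rw [hpsi]
  field_simp
  ring

/-- If `∫ d^a F` converges as `a → 0+`, with `F ≥ 0` vanishing where `d` does, then `F` is
integrable and its integral is the limit: Fatou's lemma gives integrability, after which
`F + d^ε F` dominates. -/
lemma integrable_of_tendsto_integral_rpow {α : Type*} [MeasurableSpace α] {μ : Measure α}
    {d F : α → ℝ} (hd : Measurable d) (hF : Measurable F) (hd0 : ∀ p, 0 ≤ d p)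
    (hF0 : ∀ p, 0 ≤ F p) (hdF : ∀ p, d p = 0 → F p = 0) {ε ℓ : ℝ} (hε : 0 < ε)
    (hint : ∀ a : ℝ, 0 < a → a ≤ ε → Integrable (fun p => d p ^ a * F p) μ)
    (hlim : Tendsto (fun a : ℝ => ∫ p, d p ^ a * F p ∂μ) (𝓝[>] 0) (𝓝 ℓ)) :
    Integrable F μ ∧ ∫ p, F p ∂μ = ℓ := by
  have hev : ∀ᶠ a in 𝓝[>] (0 : ℝ), 0 < a ∧ a ≤ ε :=
    Ioc_mem_nhdsGT hε
  have hnn : ∀ (a : ℝ) p, 0 ≤ d p ^ a * F p := fun a p =>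
    mul_nonneg (Real.rpow_nonneg (hd0 p) _) (hF0 p)
  have hpt : ∀ p, Tendsto (fun a : ℝ => d p ^ a * F p) (𝓝[>] 0) (𝓝 (F p)) := by
    intro p
    rcases (hd0 p).eq_or_lt with h | h
    · simp [hdF p h.symm]
    · have h1 : Tendsto (fun a : ℝ => d p ^ a * F p) (𝓝 0) (𝓝 (d p ^ (0 : ℝ) * F p)) :=
        ((Real.continuousAt_const_rpow h.ne').tendsto).mul_const _
      rw [Real.rpow_zero, one_mul] at h1
      exact h1.mono_left nhdsWithin_le_nhds
  have hFi : Integrable F μ := by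
    refine ⟨hF.aestronglyMeasurable, ?_⟩
    rw [hasFiniteIntegral_iff_ofReal (ae_of_all _ hF0)]
    calc ∫⁻ p, ENNReal.ofReal (F p) ∂μ
        = ∫⁻ p, liminf (fun a : ℝ => ENNReal.ofReal (d p ^ a * F p)) (𝓝[>] 0) ∂μ := by
          refine lintegral_congr fun p => ?_
          exact ((ENNReal.tendsto_ofReal (hpt p)).liminf_eq).symm
      _ ≤ liminf (fun a : ℝ => ∫⁻ p, ENNReal.ofReal (d p ^ a * F p) ∂μ) (𝓝[>] 0) :=
          lintegral_liminf_le fun a => by fun_prop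
      _ = ENNReal.ofReal ℓ := by
          refine Tendsto.liminf_eq ((ENNReal.tendsto_ofReal hlim).congr' ?_)
          filter_upwards [hev] with a ha
          exact ofReal_integral_eq_lintegral_ofReal (hint a ha.1 ha.2) (ae_of_all _ (hnn a))
      _ < ∞ := ENNReal.ofReal_lt_top
  refine ⟨hFi, tendsto_nhds_unique ?_ hlim⟩
  refine tendsto_integral_filter_of_dominated_convergence (fun p => F p + d p ^ ε * F p)
    (Eventually.of_forall fun a => Measurable.aestronglyMeasurable (by fun_prop)) ?_
    (hFi.add (hint ε hε le_rfl)) (ae_of_all _ hpt)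
  filter_upwards [hev] with a ha
  refine ae_of_all _ fun p => ?_
  rw [Real.norm_of_nonneg (hnn a p)]
  have hle : d p ^ a ≤ 1 + d p ^ ε := by
    rcases le_total (d p) 1 with h | h
    · have := Real.rpow_le_one (hd0 p) h ha.1.le
      have := Real.rpow_nonneg (hd0 p) ε
      linarith
    · have := Real.rpow_le_rpow_of_exponent_le h ha.2
      linarith
  have := mul_le_mul_of_nonneg_right hle (hF0 p)
  linarith

/-- On the diagonal both sides vanish, whatever the junk values of the powers of `0`. -/
lemma rieszIntegrand_eq (a : ℝ) (g : EuclideanSpace ℝ (Fin n) → ℂ)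
    (p : EuclideanSpace ℝ (Fin n) × EuclideanSpace ℝ (Fin n)) :
    rieszIntegrand a g p = Real.Gamma ((n : ℝ) / 2 - a) / Real.Gamma a * π ^ (a - (n : ℝ) / 2) *
      (‖p.1 - p.2‖ ^ (2 * a) * besovIntegrand g p) := by
  by_cases hp : p.1 = p.2
  · simp [rieszIntegrand, besovIntegrand, hp]
  have hz : 0 < ‖p.1 - p.2‖ := norm_pos_iff.2 (sub_ne_zero.2 hp)
  have : (π * ‖p.1 - p.2‖ ^ 2) ^ (a - (n : ℝ) / 2) =
      π ^ (a - (n : ℝ) / 2) * (‖p.1 - p.2‖ ^ (2 * a) / ‖p.1 - p.2‖ ^ n) := by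
    rw [Real.mul_rpow Real.pi_pos.le (by positivity), ← Real.rpow_natCast,
      ← Real.rpow_natCast, ← Real.rpow_mul hz.le, ← Real.rpow_sub hz]
    congr 2
    push_cast; ring
  rw [rieszIntegrand, riesz, this, besovIntegrand]
  ring

lemma besovIntegrand_nonneg (g : EuclideanSpace ℝ (Fin n) → ℂ)
    (p : EuclideanSpace ℝ (Fin n) × EuclideanSpace ℝ (Fin n)) : 0 ≤ besovIntegrand g p := by
  unfold besovIntegrand; positivity

lemma continuous_weighted (f : 𝓢(EuclideanSpace ℝ (Fin n), ℂ)) : Continuous (weighted f) := by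
  unfold weighted
  have h1 : Continuous fun x : EuclideanSpace ℝ (Fin n) => ‖x‖ ^ ((n : ℝ) / 2) :=
    continuous_norm.rpow_const fun x => Or.inr (by positivity)
  exact (Complex.continuous_ofReal.comp h1).mul f.continuous

lemma measurable_besovIntegrand {g : EuclideanSpace ℝ (Fin n) → ℂ} (hg : Measurable g) :
    Measurable (besovIntegrand g) := by
  unfold besovIntegrand; fun_prop

/-- The logarithmic identity, solved for the double integral. -/
lemma integral_besovIntegrand (hn : 1 ≤ n) (f : 𝓢(EuclideanSpace ℝ (Fin n), ℂ)) :
    Integrable (besovIntegrand (weighted f))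
      ((volume : Measure (EuclideanSpace ℝ (Fin n))).prod volume) ∧
    ∫ p, besovIntegrand (weighted f) p
        ∂((volume : Measure (EuclideanSpace ℝ (Fin n))).prod volume) =
      4 * π ^ ((n : ℝ) / 2) / Real.Gamma ((n : ℝ) / 2) *
      ((∫ x : EuclideanSpace ℝ (Fin n), Real.log ‖x‖ * ‖f x‖ ^ 2)
        + (∫ ξ : EuclideanSpace ℝ (Fin n), Real.log ‖ξ‖ * ‖hat f ξ‖ ^ 2)
        - logConst n * (∫ x : EuclideanSpace ℝ (Fin n), ‖f x‖ ^ 2)) := by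
  have hn' : (1 : ℝ) ≤ n := by exact_mod_cast hn
  obtain ⟨-, hA⟩ := hasDerivAt_integral_norm_rpow hn f
  obtain ⟨-, hB⟩ := hasDerivAt_integral_norm_rpow hn (𝓕⁻ f : 𝓢(EuclideanSpace ℝ (Fin n), ℂ))
  rw [← hat_eq_fourierInv] at hB
  set A : ℝ → ℝ := fun a => ∫ x : EuclideanSpace ℝ (Fin n), ‖x‖ ^ (2 * a) * ‖f x‖ ^ 2 with hAdef
  set B : ℝ → ℝ := fun a => ∫ x : EuclideanSpace ℝ (Fin n), ‖x‖ ^ (2 * a) * ‖hat f x‖ ^ 2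
    with hBdef
  set N := ∫ x : EuclideanSpace ℝ (Fin n), ‖f x‖ ^ 2 with hN
  set P := ∫ x : EuclideanSpace ℝ (Fin n), Real.log ‖x‖ * ‖f x‖ ^ 2
  set Q := ∫ ξ : EuclideanSpace ℝ (Fin n), Real.log ‖ξ‖ * ‖hat f ξ‖ ^ 2
  have hA0 : A 0 = N := by simp [hAdef, hN]
  have hB0 : B 0 = N := by simp [hBdef, hN, integral_norm_sq_hat]
  have hG4 := (Real.Gamma_pos_of_pos (show 0 < (n : ℝ) / 4 by positivity)).ne'
  have hH0 : pittFactor n 0 = 1 := by simp [pittFactor, hG4]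
  -- half the Riesz energy of the differences, as a function of `a`
  set Φ : ℝ → ℝ := fun a => pittFactor n a * A a - π ^ (-a) * B (-a) with hΦ
  have hΦ0 : Φ 0 = 0 := by simp [hΦ, hA0, hB0, hH0]
  have hpi : HasDerivAt (fun a : ℝ => π ^ (-a)) (-Real.log π) 0 := by
    simpa using (hasDerivAt_id (0 : ℝ)).neg.const_rpow Real.pi_pos
  have hBn : HasDerivAt (fun a : ℝ => B (-a)) (-(2 * Q)) 0 := by
    have h : HasDerivAt B (2 * Q) (-0) := by simpa using hB
    simpa [Function.comp_def] using h.scomp (0 : ℝ) (hasDerivAt_neg 0)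
  have hΦd : HasDerivAt Φ (2 * (P + Q - logConst n * N)) 0 := by
    refine (((hasDerivAt_pittFactor hn).mul hA).sub (hpi.mul hBn)).congr_deriv ?_
    rw [hA0, hH0, neg_zero, hB0, Real.rpow_zero, logConst]
    ring
  -- the identity with a Riesz kernel, solved for the energy
  set c : ℝ → ℝ := fun a => Real.Gamma ((n : ℝ) / 2 - a) / Real.Gamma a * π ^ (a - (n : ℝ) / 2)
    with hc
  have hcpos : ∀ a, 0 < a → a ≤ 1 / 8 → 0 < c a := fun a h0 h1 => by
    have := Real.Gamma_pos_of_pos h0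
    have := Real.Gamma_pos_of_pos (show 0 < (n : ℝ) / 2 - a by linarith)
    simp only [hc]; positivity
  have hgs : ∀ a, 0 < a → a ≤ 1 / 8 →
      Integrable (fun p : EuclideanSpace ℝ (Fin n) × EuclideanSpace ℝ (Fin n) =>
        ‖p.1 - p.2‖ ^ (2 * a) * besovIntegrand (weighted f) p) (volume.prod volume) ∧
      ∫ p, ‖p.1 - p.2‖ ^ (2 * a) * besovIntegrand (weighted f) p
        ∂((volume : Measure (EuclideanSpace ℝ (Fin n))).prod volume) = (c a)⁻¹ * (2 * Φ a) := by
    intro a h0 h1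
    obtain ⟨hi, he⟩ := ground_state hn f h0 (by linarith)
    have hca := (hcpos a h0 h1).ne'
    have hfun : rieszIntegrand a (weighted f) = fun p =>
        c a * (‖p.1 - p.2‖ ^ (2 * a) * besovIntegrand (weighted f) p) :=
      funext fun p => rieszIntegrand_eq a _ p
    rw [hfun] at hi he
    constructor
    · exact (hi.const_mul (c a)⁻¹).congr (ae_of_all _ fun p => by simp only; field_simp)
    · have hleft : ∫ ξ : EuclideanSpace ℝ (Fin n), (π * ‖ξ‖ ^ 2) ^ (-a) * ‖hat f ξ‖ ^ 2 =
          π ^ (-a) * B (-a) := by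
        simp only [hBdef]
        rw [← integral_const_mul]
        refine integral_congr_ae (ae_of_all _ fun ξ => ?_)
        simp only
        rw [Real.mul_rpow Real.pi_pos.le (by positivity), ← Real.rpow_natCast ‖ξ‖ 2,
          ← Real.rpow_mul (norm_nonneg _), mul_assoc]
        congr 3
      rw [hleft, integral_const_mul] at he
      rw [eq_inv_mul_iff_mul_eq₀ hca]
      simp only [hΦ, hAdef]
      linarith
  have hGn := Real.Gamma_pos_of_pos (show 0 < (n : ℝ) / 2 by positivity)
  -- `1 / Γ(a) = a / Γ(a + 1)` turns the identity into a difference quotient of `Φ`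
  have hlim : Tendsto (fun a => (c a)⁻¹ * (2 * Φ a)) (𝓝[>] 0)
      (𝓝 (4 * π ^ ((n : ℝ) / 2) / Real.Gamma ((n : ℝ) / 2) * (P + Q - logConst n * N))) := by
    have hslope : Tendsto (fun a => a⁻¹ * Φ a) (𝓝[>] 0) (𝓝 (2 * (P + Q - logConst n * N))) := by
      have := hΦd.tendsto_slope_zero_right
      simpa [hΦ0] using this
    have hcont : ContinuousAt (fun a : ℝ => 2 * (Real.Gamma (a + 1) /
        Real.Gamma ((n : ℝ) / 2 - a) * π ^ ((n : ℝ) / 2 - a))) 0 := by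
      have g1 : ContinuousAt (fun a : ℝ => Real.Gamma (a + 1)) 0 := by
        refine ContinuousAt.comp (f := fun a : ℝ => a + 1) (g := Real.Gamma) ?_ (by fun_prop)
        exact (Real.differentiableAt_Gamma fun m => by
          have : (0 : ℝ) ≤ m := Nat.cast_nonneg m
          linarith).continuousAt
      have g2 : ContinuousAt (fun a : ℝ => Real.Gamma ((n : ℝ) / 2 - a)) 0 := by
        refine ContinuousAt.comp (f := fun a : ℝ => (n : ℝ) / 2 - a) (g := Real.Gamma) ?_
          (by fun_prop)
        exact (Real.differentiableAt_Gamma fun m => by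
          have : (0 : ℝ) ≤ m := Nat.cast_nonneg m
          linarith).continuousAt
      have g3 : ContinuousAt (fun a : ℝ => π ^ ((n : ℝ) / 2 - a)) 0 :=
        ContinuousAt.rpow continuousAt_const (by fun_prop) (Or.inl Real.pi_pos.ne')
      exact ((g1.div g2 (by simpa using hGn.ne')).mul g3).const_mul 2
    have h := (hcont.tendsto.mono_left (nhdsWithin_le_nhds (s := Ioi 0))).mul hslope
    simp only [zero_add, sub_zero, Real.Gamma_one] at h
    rw [show 4 * π ^ ((n : ℝ) / 2) / Real.Gamma ((n : ℝ) / 2) * (P + Q - logConst n * N) =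
      2 * (1 / Real.Gamma ((n : ℝ) / 2) * π ^ ((n : ℝ) / 2)) *
        (2 * (P + Q - logConst n * N)) by ring]
    refine h.congr' ?_
    filter_upwards [Ioc_mem_nhdsGT (show (0 : ℝ) < 1 / 8 by norm_num)] with a ha
    have ha0 : 0 < a := ha.1
    have ha1 : a ≤ 1 / 8 := ha.2
    have e1 := Real.Gamma_pos_of_pos ha0
    have e2 := Real.Gamma_pos_of_pos (show 0 < (n : ℝ) / 2 - a by linarith)
    simp only [hc]
    rw [Real.Gamma_add_one ha0.ne', show a - (n : ℝ) / 2 = -((n : ℝ) / 2 - a) by ring,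
      Real.rpow_neg Real.pi_pos.le]
    field_simp
  -- `integrable_of_tendsto_integral_rpow` takes the exponent `2 * a` of `‖x - y‖` as its variable
  have hhalf : Tendsto (fun a : ℝ => a / 2) (𝓝[>] 0) (𝓝[>] 0) := by
    refine tendsto_nhdsWithin_iff.2 ⟨?_, ?_⟩
    · have : Tendsto (fun a : ℝ => a / 2) (𝓝 0) (𝓝 (0 / 2)) := tendsto_id.div_const 2
      rw [zero_div] at this
      exact this.mono_left nhdsWithin_le_nhds
    · filter_upwards [self_mem_nhdsWithin] with a ha
      exact half_pos (mem_Ioi.1 ha)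
  refine integrable_of_tendsto_integral_rpow (d := fun p => ‖p.1 - p.2‖) (ε := 1 / 4)
    (by fun_prop) (measurable_besovIntegrand (continuous_weighted f).measurable)
    (fun p => norm_nonneg _) (besovIntegrand_nonneg _) (fun p hp => ?_) (by norm_num)
    (fun a h0 h1 => ?_) ((hlim.comp hhalf).congr' ?_)
  · have : p.1 = p.2 := sub_eq_zero.1 (norm_eq_zero.1 hp)
    simp [besovIntegrand, this]
  · have := (hgs (a / 2) (by linarith) (by linarith)).1
    rwa [mul_div_cancel₀ a two_ne_zero] at this
  · filter_upwards [Ioc_mem_nhdsGT (show (0 : ℝ) < 1 / 4 by norm_num)] with a ha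
    have := (hgs (a / 2) (half_pos ha.1) (by have := ha.2; linarith)).2
    rw [mul_div_cancel₀ a two_ne_zero] at this
    exact this.symm

/-! ### Strict positivity -/

lemma integral_besovIntegrand_pos (hn : 1 ≤ n) (f : 𝓢(EuclideanSpace ℝ (Fin n), ℂ))
    (hf : f ≠ 0) :
    0 < ∫ p, besovIntegrand (weighted f) p
        ∂((volume : Measure (EuclideanSpace ℝ (Fin n))).prod volume) := by
  have : Nonempty (Fin n) := ⟨⟨0, hn⟩⟩
  have hn' : (1 : ℝ) ≤ n := by exact_mod_cast hn
  have hi := (integral_besovIntegrand hn f).1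
  have hcw := continuous_weighted f
  have h0 := besovIntegrand_nonneg (weighted (n := n) f)
  refine (integral_nonneg h0).lt_of_ne fun h => hf ?_
  have hae := (integral_eq_zero_iff_of_nonneg h0 hi).1 h.symm
  have hopen : IsOpen {p : EuclideanSpace ℝ (Fin n) × EuclideanSpace ℝ (Fin n) |
      weighted f p.1 ≠ weighted f p.2} :=
    isOpen_ne_fun (hcw.comp continuous_fst) (hcw.comp continuous_snd)
  have hzero : ((volume : Measure (EuclideanSpace ℝ (Fin n))).prod volume)
      {p : EuclideanSpace ℝ (Fin n) × EuclideanSpace ℝ (Fin n) |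
        weighted f p.1 ≠ weighted f p.2} = 0 := by
    have : ∀ᵐ p ∂((volume : Measure (EuclideanSpace ℝ (Fin n))).prod volume),
        weighted f p.1 = weighted f p.2 := by
      filter_upwards [hae, ae_ne_zero_prod hn] with p hp hp0
      by_contra hne
      have h12 : p.1 ≠ p.2 := fun h => hne (by rw [h])
      have e1 : 0 < ‖p.1‖ := norm_pos_iff.2 hp0.1
      have e2 : 0 < ‖p.2‖ := norm_pos_iff.2 hp0.2
      have e3 : 0 < ‖p.1 - p.2‖ := norm_pos_iff.2 (sub_ne_zero.2 h12)
      have e4 : 0 < ‖weighted f p.1 - weighted f p.2‖ := norm_pos_iff.2 (sub_ne_zero.2 hne)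
      have : 0 < besovIntegrand (weighted f) p := by unfold besovIntegrand; positivity
      exact this.ne' hp
    exact this
  -- the open set where `g(x) ≠ g(y)` is null, hence empty; take `y = 0`
  have hempty := (hopen.measure_eq_zero_iff _).1 hzero
  have hw0 : ∀ x, weighted f x = 0 := by
    intro x
    by_contra hne
    have hz : weighted f (0 : EuclideanSpace ℝ (Fin n)) = 0 := by
      have : (n : ℝ) / 2 ≠ 0 := by positivity
      simp [weighted, Real.zero_rpow this]
    have : (x, (0 : EuclideanSpace ℝ (Fin n))) ∈
        {p : EuclideanSpace ℝ (Fin n) × EuclideanSpace ℝ (Fin n) |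
        weighted f p.1 ≠ weighted f p.2} := by
      simpa [hz] using hne
    rw [hempty] at this
    exact this
  have hfx : ∀ x : EuclideanSpace ℝ (Fin n), x ≠ 0 → f x = 0 := by
    intro x hx
    have h1 : 0 < ‖x‖ ^ ((n : ℝ) / 2) := Real.rpow_pos_of_pos (norm_pos_iff.2 hx) _
    have h2 := hw0 x
    rw [weighted, mul_eq_zero] at h2
    exact h2.resolve_left (by exact_mod_cast h1.ne')
  have hall : (⇑f) = 0 := Continuous.ext_on (dense_compl_singleton 0) f.continuous
    continuous_const fun x hx => hfx x hx
  ext x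
  exact congrFun hall x

end LogUncertainty

theorem theorem4 (n : ℕ) (hn : 1 ≤ n) (f : 𝓢(EuclideanSpace ℝ (Fin n), ℂ)) :
    Integrable (fun x : EuclideanSpace ℝ (Fin n) => Real.log ‖x‖ * ‖f x‖ ^ 2) volume ∧
    Integrable (fun ξ : EuclideanSpace ℝ (Fin n) =>
      Real.log ‖ξ‖ * ‖LogUncertainty.hat (⇑f) ξ‖ ^ 2) volume ∧
    Integrable (LogUncertainty.besovIntegrand (LogUncertainty.weighted (⇑f)))
      ((volume : Measure (EuclideanSpace ℝ (Fin n))).prod volume) ∧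
    (∫ x : EuclideanSpace ℝ (Fin n), Real.log ‖x‖ * ‖f x‖ ^ 2)
        + (∫ ξ : EuclideanSpace ℝ (Fin n), Real.log ‖ξ‖ * ‖LogUncertainty.hat (⇑f) ξ‖ ^ 2)
        - LogUncertainty.logConst n * (∫ x : EuclideanSpace ℝ (Fin n), ‖f x‖ ^ 2)
      = (1 / 4 : ℝ) * Real.pi ^ (-((n : ℝ) / 2)) * Real.Gamma ((n : ℝ) / 2) *
        (∫ p, LogUncertainty.besovIntegrand (LogUncertainty.weighted (⇑f)) p
          ∂((volume : Measure (EuclideanSpace ℝ (Fin n))).prod volume)) ∧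
    (f ≠ 0 →
      LogUncertainty.logConst n * (∫ x : EuclideanSpace ℝ (Fin n), ‖f x‖ ^ 2) <
        (∫ x : EuclideanSpace ℝ (Fin n), Real.log ‖x‖ * ‖f x‖ ^ 2)
          + (∫ ξ : EuclideanSpace ℝ (Fin n),
              Real.log ‖ξ‖ * ‖LogUncertainty.hat (⇑f) ξ‖ ^ 2)) := by
  have hn' : (1 : ℝ) ≤ n := by exact_mod_cast hn
  have hG := Real.Gamma_pos_of_pos (show 0 < (n : ℝ) / 2 by positivity)
  have hpi := Real.rpow_pos_of_pos Real.pi_pos ((n : ℝ) / 2)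
  obtain ⟨hi, hI⟩ := LogUncertainty.integral_besovIntegrand hn f
  have hid : (∫ x : EuclideanSpace ℝ (Fin n), Real.log ‖x‖ * ‖f x‖ ^ 2)
        + (∫ ξ : EuclideanSpace ℝ (Fin n), Real.log ‖ξ‖ * ‖LogUncertainty.hat (⇑f) ξ‖ ^ 2)
        - LogUncertainty.logConst n * (∫ x : EuclideanSpace ℝ (Fin n), ‖f x‖ ^ 2)
      = (1 / 4 : ℝ) * Real.pi ^ (-((n : ℝ) / 2)) * Real.Gamma ((n : ℝ) / 2) *
        (∫ p, LogUncertainty.besovIntegrand (LogUncertainty.weighted (⇑f)) p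
          ∂((volume : Measure (EuclideanSpace ℝ (Fin n))).prod volume)) := by
    rw [hI, Real.rpow_neg Real.pi_pos.le]
    field_simp
  refine ⟨(LogUncertainty.hasDerivAt_integral_norm_rpow hn f).1, ?_, hi, hid, fun hf => ?_⟩
  · rw [LogUncertainty.hat_eq_fourierInv]
    exact (LogUncertainty.hasDerivAt_integral_norm_rpow hn _).1
  · have hJ := LogUncertainty.integral_besovIntegrand_pos hn f hf
    rw [← sub_pos, hid]
    positivity
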